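/- Let $G$ be a compact topological group, let $E$ and $B$ be $G$-spaces (topological spaces with a continuous action of $G$), with $B$ paracompact Hausdorff, and let $p : E \to B$ be a continuous equivariant map. Call a continuous equivariant map $q : Y \to Z$ of $G$-spaces a Hurewicz $G$-fibration if for every $G$-space $X$, every continuous equivariant map $f : X \to Y$ and every continuous equivariant map $F : X \times [0,1] \to Z$ (with $G$ acting trivially on $[0,1]$) such that $F(x,0) = q(f(x))$ for all $x \in X$, there is a continuous equivariant map $\tilde F : X \times [0,1] \to Y$ with $q \circ \tilde F = F$ and $\tilde F(x,0) = f(x)$ for all $x \in X$. Call $p$ a local Hurewicz $G$-fibration if every point $b \in B$ has a $G$-invariant neighborhood $U$ such that the restriction $p|_{p^{-1}(U)} : p^{-1}(U) \to U$ is a Hurewicz $G$-fibration. Then $p$ is a Hurewicz $G$-fibration if and only if it is a local Hurewicz $G$-fibration. -/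

import Mathlib

open Topology
open scoped unitInterval

universe u v w

/-- A `G`-mapping between `G`-spaces: a continuous map commuting with the action of `G`. -/
structure IsGMap (G : Type*) {X Y : Type*} [TopologicalSpace X] [TopologicalSpace Y]
    [SMul G X] [SMul G Y] (f : X → Y) : Prop where
  continuous : Continuous f
  map_smul : ∀ (g : G) (x : X), f (g • x) = g • f x

/-- A `G`-homotopy: a continuous map `X × I → Y` which is equivariant, where `G` acts on
`X × I` by `g • (x, t) = (g • x, t)`. -/
structure IsGHomotopy (G : Type*) {X Y : Type*} [TopologicalSpace X] [TopologicalSpace Y]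
    [SMul G X] [SMul G Y] (F : X × I → Y) : Prop where
  continuous : Continuous F
  map_smul : ∀ (g : G) (x : X) (t : I), F (g • x, t) = g • F (x, t)

/-- The equivariant covering homotopy property of `p : E → B` with respect to the `G`-space
`X`. -/
def HasGCoveringHomotopy (G : Type*) {E B : Type*} [TopologicalSpace E] [TopologicalSpace B]
    [SMul G E] [SMul G B] (p : E → B) (X : Type*) [TopologicalSpace X] [SMul G X] : Prop :=
  ∀ (f : X → E) (F : X × I → B), IsGMap G f → IsGHomotopy G F → (∀ x, F (x, 0) = p (f x)) →
    ∃ F' : X × I → E, IsGHomotopy G F' ∧ (∀ z, p (F' z) = F z) ∧ ∀ x, F' (x, 0) = f x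

/-- Hurewicz `G`-fibrations: equivariant maps having the equivariant covering homotopy
property with respect to every `G`-space. The test spaces range over the universe
`max u v`, which contains the subspace `{(e, α) | α 0 = p e}` of `E × C(I, B)`,
the universal test space. -/
structure IsHurewiczGFibration (G : Type w) [TopologicalSpace G] [Group G] {E : Type u}
    {B : Type v} [TopologicalSpace E] [TopologicalSpace B] [SMul G E] [SMul G B]
    (p : E → B) : Prop where
  isGMap : IsGMap G p
  hasGCoveringHomotopy : ∀ (X : Type (max u v)) [TopologicalSpace X] [MulAction G X]
    [ContinuousSMul G X], HasGCoveringHomotopy G p X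

/-- The inverse image of an invariant subset under an equivariant map, as an invariant
subset. -/
def IsGMap.preimage {G E B : Type*} [TopologicalSpace E] [TopologicalSpace B]
    [SMul G E] [SMul G B] {p : E → B} (hp : IsGMap G p) (U : SubMulAction G B) :
    SubMulAction G E where
  carrier := p ⁻¹' (U : Set B)
  smul_mem' g e he := by
    rw [Set.mem_preimage, hp.map_smul]
    exact U.smul_mem g he

/-- The restriction `p⁻¹(U) → U` of an equivariant map over an invariant subset `U`. -/
def IsGMap.restrict {G E B : Type*} [TopologicalSpace E] [TopologicalSpace B]
    [SMul G E] [SMul G B] {p : E → B} (hp : IsGMap G p) (U : SubMulAction G B) :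
    hp.preimage U → U :=
  fun e => ⟨p e.1, e.2⟩

/-- Local Hurewicz `G`-fibrations: equivariant maps such that every point of the base has an
invariant neighbourhood over which the map is a Hurewicz `G`-fibration. -/
def IsLocalHurewiczGFibration (G : Type w) [TopologicalSpace G] [Group G] {E : Type u}
    {B : Type v} [TopologicalSpace E] [TopologicalSpace B] [MulAction G E] [MulAction G B]
    (p : E → B) : Prop :=
  ∃ hp : IsGMap G p, ∀ b : B, ∃ U : SubMulAction G B,
    (U : Set B) ∈ 𝓝 b ∧ IsHurewiczGFibration G (hp.restrict U)

/-! Globality of the property gives one direction, with the whole base as the invariant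
neighbourhood. For the converse, a fibration over an invariant `U` has an equivariant lifting
function for paths in `U`, and a partition of unity becomes `G`-invariant by taking suprema over
orbits; compactness of `G` preserves continuity, local finiteness and the support condition. This
yields `GLiftingCover`.

A homotopy `F` is then lifted by prolonging partial lifts. From time `a`, the `i`-th lifting
function is used for the time `ρ = ½ min_{s ∈ [0,1]} (s + φ i (F (x, a + s)))`, which is continuous
and invariant; if `ρ > 0`, then `F` stays in `{φ i > 0}` throughout, and if `ρ = 0` nothing changes.
A round applies all relevant indices in a fixed order; locally in `x` it is one finite composition,
hence continuous (`isContinuousFamily_pass`). Compactness of `[0,1]` bounds the progress per round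
below, locally uniformly in `x`, so finitely many rounds reach time 1
(`eventually_one_le_stage_fst`). Later rounds leave earlier values alone, so the stages glue. All
choices are independent of `x`, which gives equivariance. -/

/-- Projection along a compact factor preserves local finiteness. -/
theorem LocallyFinite.image_fst_of_compactSpace {ι X K : Type*} [TopologicalSpace X]
    [TopologicalSpace K] [CompactSpace K] {A : ι → Set (X × K)} (hA : LocallyFinite A) :
    LocallyFinite fun i => Prod.fst '' A i := by
  intro x
  -- Tube argument: one finite index set serves all of `K` over a neighbourhood of `x`.
  have key : ∃ S : Set ι, S.Finite ∧
      ∀ᶠ y in 𝓝 x, ∀ k ∈ (Set.univ : Set K), ∀ i, (y, k) ∈ A i → i ∈ S := by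
    refine isCompact_univ.induction_on
      (p := fun s : Set K => ∃ S : Set ι, S.Finite ∧
        ∀ᶠ y in 𝓝 x, ∀ k ∈ s, ∀ i, (y, k) ∈ A i → i ∈ S) ?_ ?_ ?_ ?_
    · exact ⟨∅, Set.finite_empty, by simp⟩
    · rintro s t hst ⟨S, hS, h⟩
      exact ⟨S, hS, h.mono fun y hy k hk => hy k (hst hk)⟩
    · rintro s t ⟨S, hS, h⟩ ⟨S', hS', h'⟩
      refine ⟨S ∪ S', hS.union hS', ?_⟩
      filter_upwards [h, h'] with y hy hy' k hk i hi
      exact hk.elim (fun hk => Or.inl (hy k hk i hi)) fun hk => Or.inr (hy' k hk i hi)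
    · intro k _
      obtain ⟨N, hN, hfin⟩ := hA (x, k)
      obtain ⟨V, hV, W, hW, hVW⟩ := mem_nhds_prod_iff.1 hN
      refine ⟨W, mem_nhdsWithin_of_mem_nhds hW, _, hfin, ?_⟩
      filter_upwards [hV] with y hy l hl i hi
      exact ⟨(y, l), hi, hVW ⟨hy, hl⟩⟩
  obtain ⟨S, hS, h⟩ := key
  refine ⟨_, h, hS.subset ?_⟩
  rintro i ⟨_, ⟨⟨y, k⟩, hyk, rfl⟩, hy⟩
  exact hy k trivial i hyk

theorem SubMulAction.smul_mem_interior {G B : Type*} [Group G] [TopologicalSpace B]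
    [MulAction G B] [ContinuousConstSMul G B] (U : SubMulAction G B) (g : G) {b : B}
    (hb : b ∈ interior (U : Set B)) : g • b ∈ interior (U : Set B) := by
  have hU : (fun x : B => g⁻¹ • x) ⁻¹' (U : Set B) = U := by
    ext x
    exact U.smul_mem_iff' g⁻¹
  have h : (fun x : B => g⁻¹ • x) ⁻¹' interior (U : Set B) ⊆ interior (U : Set B) :=
    (preimage_interior_subset_interior_preimage (continuous_const_smul g⁻¹)).trans_eq
      (congrArg interior hU)
  exact h (by simpa using hb)

/-! ### Lifting functions over invariant subsets -/

/-- An equivariant lifting function over a subset `U` of the base: a continuous choice of lifts of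
the paths in `U`. Its values at pairs `(e, α)` that pose no lifting problem over `U` are only
required to start at `e`. -/
structure GLiftingFunction (G : Type*) {E B : Type*} [TopologicalSpace G] [Group G]
    [TopologicalSpace E] [TopologicalSpace B] [MulAction G E] [MulAction G B]
    [ContinuousSMul G B] (p : E → B) (U : Set B) where
  toFun : E → C(I, B) → I → E
  apply_zero : ∀ e α, toFun e α 0 = e
  lift : ∀ e α, α 0 = p e → (∀ t, α t ∈ U) → ∀ t, p (toFun e α t) = α t
  map_smul : ∀ (g : G) e α t, toFun (g • e) (g • α) t = g • toFun e α t
  continuousOn : ContinuousOn (fun z : (E × C(I, B)) × I => toFun z.1.1 z.1.2 z.2)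
    {z | z.1.2 0 = p z.1.1 ∧ ∀ t, z.1.2 t ∈ U}

section

variable {G : Type w} [TopologicalSpace G] [Group G] {E : Type u} [TopologicalSpace E]
  [MulAction G E] {B : Type v} [TopologicalSpace B] [MulAction G B] {p : E → B}

/-- The lifting problems for paths in an invariant subset `U` of the base. -/
def IsGMap.liftingProblems [ContinuousSMul G B] (hp : IsGMap G p) (U : SubMulAction G B) :
    SubMulAction G (E × C(I, B)) where
  carrier := {z | z.2 0 = p z.1 ∧ ∀ t, z.2 t ∈ U}
  smul_mem' g z hz := by
    refine ⟨?_, fun t => U.smul_mem g (hz.2 t)⟩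
    change g • z.2 0 = p (g • z.1)
    rw [hp.map_smul, hz.1]

/-- The lifting problems themselves form a `G`-space `D`; lifting the tautological homotopy `(e, α,
t) ↦ α t` on it solves all of them at once, continuously and equivariantly. -/
theorem IsHurewiczGFibration.nonempty_gLiftingFunction [ContinuousSMul G E] [ContinuousSMul G B]
    {hp : IsGMap G p} {U : SubMulAction G B} (h : IsHurewiczGFibration G (hp.restrict U)) :
    Nonempty (GLiftingFunction G p (U : Set B)) := by
  classical
  let D := hp.liftingProblems U
  have hD (z : D) : p z.1.1 ∈ U := z.2.1 ▸ z.2.2 0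
  obtain ⟨L, hL, hpL, hL0⟩ := h.hasGCoveringHomotopy D
    (fun z => ⟨z.1.1, hD z⟩) (fun y => ⟨y.1.1.2 y.2, y.1.2.2 y.2⟩)
    ⟨by fun_prop, fun g x => rfl⟩
    ⟨Continuous.subtype_mk (by fun_prop) _, fun g x t => rfl⟩
    (fun x => Subtype.ext x.2.1)
  refine ⟨⟨fun e α t => if h : (e, α) ∈ D then (L (⟨(e, α), h⟩, t)).1 else e, ?_, ?_, ?_, ?_⟩⟩
  · intro e α
    split_ifs with h
    · rw [hL0]
    · rfl
  · intro e α h0 hU t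
    rw [dif_pos (show (e, α) ∈ D from ⟨h0, hU⟩)]
    exact congrArg Subtype.val (hpL _)
  · intro g e α t
    by_cases h : (e, α) ∈ D
    · have h' : (g • e, g • α) ∈ D := D.smul_mem g h
      rw [dif_pos h, dif_pos h']
      exact congrArg Subtype.val (hL.map_smul g ⟨(e, α), h⟩ t)
    · have h' : (g • e, g • α) ∉ D := fun h' => h ((D.smul_mem_iff' g (x := (e, α))).1 h')
      rw [dif_neg h, dif_neg h']
  · rw [continuousOn_iff_continuous_domRestrict]
    let S : Set ((E × C(I, B)) × I) := {z | z.1.2 0 = p z.1.1 ∧ ∀ t, z.1.2 t ∈ (U : Set B)}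
    have hc : Continuous fun z : S => (L ((⟨z.1.1, z.2⟩ : D), z.1.2)).1 :=
      continuous_subtype_val.comp (hL.continuous.comp (by fun_prop))
    refine hc.congr fun z => ?_
    have hz : z.1.1 ∈ D := z.2
    simp only [Set.domRestrict_apply]
    rw [dif_pos hz]

/-! ### Invariant covers with lifting functions -/

/-- A locally finite cover of the base by invariant cozero sets, with lifting functions over
neighbourhoods of their closures. -/
structure GLiftingCover (G : Type w) [TopologicalSpace G] [Group G] {E : Type u}
    [TopologicalSpace E] [MulAction G E] {B : Type v} [TopologicalSpace B] [MulAction G B]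
    [ContinuousSMul G B] (p : E → B) (ι : Type*) where
  U : ι → Set B
  isOpen_U : ∀ i, IsOpen (U i)
  φ : ι → B → ℝ
  continuous_φ : ∀ i, Continuous (φ i)
  φ_nonneg : ∀ i b, 0 ≤ φ i b
  φ_le_one : ∀ i b, φ i b ≤ 1
  φ_smul : ∀ i (g : G) b, φ i (g • b) = φ i b
  exists_pos : ∀ b, ∃ i, 0 < φ i b
  locallyFinite : LocallyFinite fun i => Function.support (φ i)
  tsupport_subset : ∀ i, tsupport (φ i) ⊆ U i
  lifting : ∀ i, GLiftingFunction G p (U i)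

/-- A real function averaged by taking suprema over the orbits of a compact group. -/
noncomputable def orbitSup (G : Type*) {B : Type*} [SMul G B] (ψ : B → ℝ) (b : B) : ℝ :=
  sSup ((fun g : G => ψ (g • b)) '' Set.univ)

theorem orbitSup_smul {G B : Type*} [Group G] [MulAction G B] {ψ : B → ℝ}
    (g : G) (b : B) : orbitSup G ψ (g • b) = orbitSup G ψ b := by
  unfold orbitSup
  congr 1
  ext r
  constructor
  · rintro ⟨k, -, rfl⟩
    exact ⟨k * g, trivial, by simp [mul_smul]⟩
  · rintro ⟨k, -, rfl⟩
    exact ⟨k * g⁻¹, trivial, by simp [mul_smul]⟩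

section orbitSup

variable [CompactSpace G] [ContinuousSMul G B] {ψ : B → ℝ}

theorem continuous_orbitSup (hψ : Continuous ψ) : Continuous (orbitSup G ψ) :=
  isCompact_univ.continuous_sSup (f := fun (b : B) (g : G) => ψ (g • b)) (by
    change Continuous fun z : B × G => ψ (z.2 • z.1)
    fun_prop)

theorem le_orbitSup (hψ : Continuous ψ) (g : G) (b : B) : ψ (g • b) ≤ orbitSup G ψ b :=
  le_csSup (isCompact_univ.image (by fun_prop)).bddAbove ⟨g, trivial, rfl⟩

theorem exists_orbitSup_eq (hψ : Continuous ψ) (b : B) :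
    ∃ g : G, orbitSup G ψ b = ψ (g • b) := by
  obtain ⟨g, -, hg⟩ := (isCompact_univ.image (f := fun g : G => ψ (g • b)) (by fun_prop)).sSup_mem
    (Set.univ_nonempty.image _)
  exact ⟨g, hg.symm⟩

end orbitSup

/-- The orbit supremum is attained, so its support consists of points with a translate in the
support of `ψ i`. This is a projection along compact `G`, which preserves local finiteness and
closedness; invariance of `U i` keeps the closed support inside its interior. -/
theorem IsLocalHurewiczGFibration.nonempty_gLiftingCover [IsTopologicalGroup G] [CompactSpace G]
    [ContinuousSMul G E] [ContinuousSMul G B] [T2Space B] [ParacompactSpace B]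
    (h : IsLocalHurewiczGFibration G p) : Nonempty (GLiftingCover G p B) := by
  obtain ⟨hp, h⟩ := h
  choose U hU hfib using h
  obtain ⟨ψ, hψ⟩ := PartitionOfUnity.exists_isSubordinate isClosed_univ
    (fun b => interior (U b : Set B)) (fun b => isOpen_interior)
    (fun b _ => Set.mem_iUnion.2 ⟨b, mem_interior_iff_mem_nhds.2 (hU b)⟩)
  have hc (i : B) : Continuous (ψ i) := (ψ i).continuous
  let L (i : B) := (hfib i).nonempty_gLiftingFunction.some
  have hsupp (i : B) : Function.support (orbitSup G (ψ i)) ⊆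
      Prod.snd '' {z : G × B | z.1 • z.2 ∈ tsupport (ψ i)} := by
    intro b hb
    obtain ⟨g, hg⟩ := exists_orbitSup_eq (G := G) (hc i) b
    refine ⟨(g, b), subset_tsupport _ ?_, rfl⟩
    rw [Function.mem_support] at hb ⊢
    rwa [← hg]
  refine ⟨⟨fun i => interior (U i : Set B), fun i => isOpen_interior, fun i => orbitSup G (ψ i),
    fun i => continuous_orbitSup (hc i), fun i b => ?_, fun i b => ?_,
    fun i g b => orbitSup_smul g b,
    fun b => ?_, ?_, fun i => ?_, fun i => ?_⟩⟩
  · exact (ψ.nonneg i _).trans (le_orbitSup (hc i) (1 : G) b)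
  · obtain ⟨g, hg⟩ := exists_orbitSup_eq (G := G) (hc i) b
    exact hg.trans_le (ψ.le_one i _)
  · obtain ⟨i, hi⟩ := ψ.exists_pos (Set.mem_univ b)
    exact ⟨i, hi.trans_le (by simpa using le_orbitSup (hc i) (1 : G) b)⟩
  · have := (ψ.locallyFinite.preimage_continuous
      (g := fun z : B × G => z.2 • z.1) (by fun_prop)).image_fst_of_compactSpace
    refine this.subset fun i b hb => ?_
    obtain ⟨g, hg⟩ := exists_orbitSup_eq (G := G) (hc i) b
    refine ⟨(b, g), ?_, rfl⟩
    simp only [Set.mem_preimage, Function.mem_support] at hb ⊢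
    rwa [← hg]
  · refine (closure_minimal (hsupp i) (isClosedMap_snd_of_compactSpace _
      ((isClosed_tsupport _).preimage continuous_smul))).trans ?_
    rintro _ ⟨⟨g, b⟩, hb, rfl⟩
    have := (U i).smul_mem_interior g⁻¹ (hψ i hb)
    simpa using this
  · exact ⟨(L i).toFun, (L i).apply_zero,
      fun e α h0 hα => (L i).lift e α h0 fun t => interior_subset (hα t), (L i).map_smul,
      (L i).continuousOn.mono fun z hz => ⟨hz.1, fun t => interior_subset (hz.2 t)⟩⟩

theorem IsHurewiczGFibration.isLocalHurewiczGFibration (h : IsHurewiczGFibration G p) :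
    IsLocalHurewiczGFibration G p := by
  refine ⟨h.isGMap, fun b => ⟨⊤, Filter.univ_mem, ⟨⟨?_, ?_⟩, ?_⟩⟩⟩
  · exact (h.isGMap.continuous.comp continuous_subtype_val).subtype_mk _
  · exact fun g x => Subtype.ext (h.isGMap.map_smul g x.1)
  · intro X _ _ _ f F hf hF hfF
    obtain ⟨F', hF', hpF', hF'0⟩ := h.hasGCoveringHomotopy X (fun x => (f x).1)
      (fun z => (F z).1)
      ⟨continuous_subtype_val.comp hf.continuous, fun g x => congrArg Subtype.val (hf.map_smul g x)⟩
      ⟨continuous_subtype_val.comp hF.continuous,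
        fun g x t => congrArg Subtype.val (hF.map_smul g x t)⟩
      (fun x => congrArg Subtype.val (hfF x))
    exact ⟨fun z => ⟨F' z, trivial⟩, ⟨hF'.continuous.subtype_mk _,
      fun g x t => Subtype.ext (hF'.map_smul g x t)⟩, fun z => Subtype.ext (hpF' z),
      fun x => Subtype.ext (hF'0 x)⟩

end

/-! ### Partial lifts of a homotopy -/

/-- A homotopy extended to all real times, constantly outside the unit interval. -/
noncomputable def ContinuousMap.extendTime {X B : Type*} [TopologicalSpace X] [TopologicalSpace B]
    (F : C(X × I, B)) : C(X × ℝ, B) where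
  toFun z := F (z.1, Set.projIcc 0 1 zero_le_one z.2)

/-- The paths traced by a homotopy `F`: at `(x, a, r)` it runs from time `a` to time `a + r` and
then stops. -/
noncomputable def ContinuousMap.segment {X B : Type*} [TopologicalSpace X] [TopologicalSpace B]
    (F : C(X × I, B)) : C(X × ℝ × ℝ, C(I, B)) :=
  ContinuousMap.curry ⟨fun y => F.extendTime (y.1.1, y.1.2.1 + min (y.2 : ℝ) y.1.2.2), by fun_prop⟩

theorem ContinuousMap.segment_apply {X B : Type*} [TopologicalSpace X] [TopologicalSpace B]
    (F : C(X × I, B)) (x : X) (a r : ℝ) (s : I) :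
    F.segment (x, a, r) s = F.extendTime (x, a + min (s : ℝ) r) :=
  rfl

theorem IsGHomotopy.extendTime_smul {G X B : Type*} [TopologicalSpace X] [TopologicalSpace B]
    [SMul G X] [SMul G B] {F : C(X × I, B)} (hF : IsGHomotopy G F) (g : G) (x : X) (t : ℝ) :
    F.extendTime (g • x, t) = g • F.extendTime (x, t) :=
  hF.map_smul g x _

/-- A lift over `x` of the homotopy `F` stopped at the time `s.1`. -/
structure IsPartialLift {X E B : Type*} [TopologicalSpace X] [TopologicalSpace B] (p : E → B)
    (f : X → E) (F : C(X × I, B)) (x : X) (s : ℝ × (ℝ → E)) : Prop where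
  nonneg : 0 ≤ s.1
  zero : s.2 0 = f x
  apply_min : ∀ t, s.2 (min t s.1) = s.2 t
  lift : ∀ t, p (s.2 t) = F.extendTime (x, min t s.1)

/-- Joint continuity of a family of stopping times and paths. -/
structure IsContinuousFamily {X E : Type*} [TopologicalSpace X] [TopologicalSpace E]
    (S : X → ℝ × (ℝ → E)) : Prop where
  time : Continuous fun x => (S x).1
  path : Continuous fun z : X × ℝ => (S z.1).2 z.2

theorem isContinuousFamily_of_eventuallyEq {X E : Type*} [TopologicalSpace X] [TopologicalSpace E]
    {S : X → ℝ × (ℝ → E)}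
    (h : ∀ x, ∃ S' : X → ℝ × (ℝ → E), IsContinuousFamily S' ∧ ∀ᶠ y in 𝓝 x, S y = S' y) :
    IsContinuousFamily S := by
  constructor
  · refine continuous_iff_continuousAt.2 fun x => ?_
    obtain ⟨S', hS', hx⟩ := h x
    exact hS'.time.continuousAt.congr (hx.mono fun y hy => congrArg Prod.fst hy.symm)
  · refine continuous_iff_continuousAt.2 fun z => ?_
    obtain ⟨S', hS', hz⟩ := h z.1
    exact hS'.path.continuousAt.congr
      ((continuous_fst.tendsto z).eventually hz |>.mono fun y hy =>
        congrFun (congrArg Prod.snd hy.symm) y.2)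

/-- The action on a stopping time and a path that is pointwise on the path. -/
def smulPath {G E : Type*} [SMul G E] (g : G) (s : ℝ × (ℝ → E)) : ℝ × (ℝ → E) :=
  (s.1, fun t => g • s.2 t)

/-! ### Extension by a single lifting function -/

namespace GLiftingCover

variable {G : Type w} [TopologicalSpace G] [Group G] {E : Type u} [TopologicalSpace E]
  [MulAction G E] {B : Type v} [TopologicalSpace B] [MulAction G B] [ContinuousSMul G B]
  {p : E → B} {ι : Type*} (c : GLiftingCover G p ι) {X : Type*} [TopologicalSpace X]
  {f : X → E} (F : C(X × I, B)) (i : ι)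

/-- A length of time, starting from `a`, during which the homotopy stays in the `i`-th cozero set
of the cover. -/
noncomputable def stepLength (x : X) (a : ℝ) : ℝ :=
  sInf ((fun s => s + c.φ i (F.extendTime (x, a + s))) '' Set.Icc 0 1) / 2

theorem two_mul_stepLength_le (x : X) (a : ℝ) {s : ℝ} (hs : s ∈ Set.Icc (0 : ℝ) 1) :
    2 * c.stepLength F i x a ≤ s + c.φ i (F.extendTime (x, a + s)) := by
  have h : sInf ((fun s => s + c.φ i (F.extendTime (x, a + s))) '' Set.Icc 0 1) ≤
      s + c.φ i (F.extendTime (x, a + s)) := by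
    refine csInf_le ⟨0, ?_⟩ ⟨s, hs, rfl⟩
    rintro _ ⟨t, ht, rfl⟩
    exact add_nonneg ht.1 (c.φ_nonneg i _)
  unfold stepLength
  linarith

theorem le_stepLength {x : X} {a r : ℝ}
    (h : ∀ s ∈ Set.Icc (0 : ℝ) 1, 2 * r ≤ s + c.φ i (F.extendTime (x, a + s))) :
    r ≤ c.stepLength F i x a := by
  have : 2 * r ≤ sInf ((fun s => s + c.φ i (F.extendTime (x, a + s))) '' Set.Icc 0 1) := by
    refine le_csInf ((Set.nonempty_Icc.2 zero_le_one).image _) ?_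
    rintro _ ⟨t, ht, rfl⟩
    exact h t ht
  unfold stepLength
  linarith

theorem stepLength_nonneg (x : X) (a : ℝ) : 0 ≤ c.stepLength F i x a :=
  c.le_stepLength F i fun s hs => by linarith [hs.1, c.φ_nonneg i (F.extendTime (x, a + s))]

theorem stepLength_le_one (x : X) (a : ℝ) : c.stepLength F i x a ≤ 1 := by
  have := c.two_mul_stepLength_le F i x a (s := 0) ⟨le_rfl, zero_le_one⟩
  linarith [c.φ_le_one i (F.extendTime (x, a + 0))]

/-- The factor ½ leaves room: `φ ≥ 2ρ - s ≥ ρ > 0` for `s ≤ ρ`. -/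
theorem φ_pos_of_le_stepLength {x : X} {a s : ℝ} (h : 0 < c.stepLength F i x a) (hs : 0 ≤ s)
    (hs' : s ≤ c.stepLength F i x a) : 0 < c.φ i (F.extendTime (x, a + s)) := by
  have := c.two_mul_stepLength_le F i x a (s := s) ⟨hs, hs'.trans (c.stepLength_le_one F i x a)⟩
  linarith

theorem continuous_stepLength : Continuous fun z : X × ℝ => c.stepLength F i z.1 z.2 := by
  have hc := c.continuous_φ i
  have := isCompact_Icc.continuous_sInf (K := Set.Icc (0 : ℝ) 1)
    (f := fun (z : X × ℝ) (s : ℝ) => s + c.φ i (F.extendTime (z.1, z.2 + s))) (by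
      change Continuous fun y : (X × ℝ) × ℝ => y.2 + c.φ i (F.extendTime (y.1.1, y.1.2 + y.2))
      fun_prop)
  exact this.div_const 2

/-- Extend a partial lift by the `i`-th lifting function. -/
noncomputable def step (x : X) (s : ℝ × (ℝ → E)) : ℝ × (ℝ → E) :=
  (s.1 + c.stepLength F i x s.1, fun t =>
    if t ≤ s.1 then s.2 t
    else (c.lifting i).toFun (s.2 s.1) (F.segment (x, s.1, c.stepLength F i x s.1))
      (Set.projIcc 0 1 zero_le_one (min (t - s.1) (c.stepLength F i x s.1))))

variable {F i}

theorem segment_mem {x : X} {a : ℝ} (h : 0 < c.stepLength F i x a) (s : I) :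
    F.segment (x, a, c.stepLength F i x a) s ∈ tsupport (c.φ i) :=
  subset_tsupport _ (c.φ_pos_of_le_stepLength F i h (le_min s.2.1 h.le) (min_le_right _ _)).ne'

/-- A partial lift is constant after its stopping time, and the lifting function starts at its first
argument even when no lifting problem over `U i` is posed, so the two agree exactly. -/
theorem step_of_stepLength_eq_zero {x : X} {s : ℝ × (ℝ → E)} (hs : IsPartialLift p f F x s)
    (h : c.stepLength F i x s.1 = 0) : c.step F i x s = s := by
  refine Prod.ext (by simp [step, h]) (funext fun t => ?_)
  simp only [step, h]
  split_ifs with ht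
  · rfl
  · rw [min_eq_right (by linarith), Set.projIcc_left]
    refine ((c.lifting i).apply_zero _ _).trans ?_
    rw [← hs.apply_min t, min_eq_right (by linarith)]

theorem isPartialLift_step {x : X} {s : ℝ × (ℝ → E)} (hs : IsPartialLift p f F x s) :
    IsPartialLift p f F x (c.step F i x s) := by
  rcases (c.stepLength_nonneg F i x s.1).eq_or_lt with h | h
  · rwa [c.step_of_stepLength_eq_zero hs h.symm]
  have h1 := c.stepLength_le_one F i x s.1
  refine ⟨add_nonneg hs.nonneg h.le, ?_, fun t => ?_, fun t => ?_⟩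
  · simp only [step, if_pos hs.nonneg, hs.zero]
  · simp only [step]
    rcases le_total t (s.1 + c.stepLength F i x s.1) with ht | ht
    · rw [min_eq_left ht]
    · rw [min_eq_right ht, if_neg (by linarith), if_neg (by linarith), add_sub_cancel_left,
        min_self, min_eq_right (by linarith)]
  · simp only [step]
    split_ifs with ht
    · rw [hs.lift, min_eq_left ht, min_eq_left (by linarith)]
    · rw [(c.lifting i).lift, ContinuousMap.segment_apply, Set.coe_projIcc]
      · congr 2
        push Not at ht
        rcases le_total (t - s.1) (c.stepLength F i x s.1) with h' | h'
        · rw [min_eq_left h', min_eq_right (h'.trans h1), max_eq_right (sub_nonneg.2 ht.le),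
            min_eq_left h', min_eq_left (by linarith)]
          ring
        · rw [min_eq_right h', min_eq_right h1, max_eq_right h.le, min_self,
            min_eq_right (by linarith)]
      · rw [hs.lift, ContinuousMap.segment_apply, min_self]
        simp [h.le]
      · exact fun r => c.tsupport_subset i (c.segment_mem h r)

/-- The lifting function is continuous only where the segment lies in `U i`, an open condition on
`x`. Elsewhere the step is locally the identity: on the closure of `{ρ > 0}` segments stay in
`tsupport (c.φ i)`, hence in `U i`. -/
theorem isContinuousFamily_step {S : X → ℝ × (ℝ → E)} (hS : ∀ x, IsPartialLift p f F x (S x))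
    (hc : IsContinuousFamily S) : IsContinuousFamily fun x => c.step F i x (S x) := by
  have hT := hc.time
  have hρ : Continuous fun x => c.stepLength F i x (S x).1 :=
    (c.continuous_stepLength F i).comp (by fun_prop : Continuous fun x => (x, (S x).1))
  have hseg : Continuous fun x => F.segment (x, (S x).1, c.stepLength F i x (S x).1) := by
    fun_prop
  refine ⟨hT.add hρ, continuous_iff_continuousAt.2 fun z => ?_⟩
  let N : Set X := {x | ∀ s, F.segment (x, (S x).1, c.stepLength F i x (S x).1) s ∈ c.U i}
  by_cases hz : z.1 ∈ N
  · have hN : IsOpen N := by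
      have := (ContinuousMap.isOpen_setOfPred_mapsTo (X := I) isCompact_univ
        (c.isOpen_U i)).preimage hseg
      convert this using 1
      ext x
      simp [N, Set.MapsTo]
    have hT' : Continuous fun y : N × ℝ => (S y.1).1 :=
      hT.comp (by fun_prop : Continuous fun y : N × ℝ => y.1.1)
    have hρ' : Continuous fun y : N × ℝ => c.stepLength F i y.1 (S y.1).1 :=
      hρ.comp (by fun_prop : Continuous fun y : N × ℝ => y.1.1)
    have hcont : Continuous fun y : N × ℝ => (c.step F i y.1 (S y.1)).2 y.2 := by
      refine Continuous.if_le ?_ ?_ continuous_snd hT' ?_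
      · exact hc.path.comp (by fun_prop : Continuous fun y : N × ℝ => (y.1.1, y.2))
      · have hend : Continuous fun y : N × ℝ => (S y.1).2 (S y.1).1 :=
          hc.path.comp
            ((continuous_subtype_val.comp continuous_fst).prodMk hT')
        have hproj : Continuous fun y : N × ℝ => Set.projIcc (0 : ℝ) 1 zero_le_one
            (min (y.2 - (S y.1).1) (c.stepLength F i y.1 (S y.1).1)) :=
          continuous_projIcc.comp (by fun_prop)
        have hseg' : Continuous fun y : N × ℝ =>
            F.segment (y.1.1, (S y.1).1, c.stepLength F i y.1 (S y.1).1) :=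
          hseg.comp (by fun_prop : Continuous fun y : N × ℝ => y.1.1)
        refine (c.lifting i).continuousOn.comp_continuous ((hend.prodMk hseg').prodMk hproj) ?_
        rintro ⟨y, t⟩
        refine ⟨?_, y.2⟩
        simp [ContinuousMap.segment_apply, (hS y.1).lift, c.stepLength_nonneg]
      · rintro ⟨y, t⟩ (rfl : t = (S y.1).1)
        simp [c.stepLength_nonneg, (c.lifting i).apply_zero]
    have hopen : IsOpenEmbedding fun y : N × ℝ => (y.1.1, y.2) :=
      hN.isOpenEmbedding_subtypeVal.prodMap .id
    exact (hopen.continuousAt_iff (x := (⟨z.1, hz⟩, z.2))).1 hcont.continuousAt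
  · have hz' : z.1 ∉ closure {x | 0 < c.stepLength F i x (S x).1} := by
      refine fun h => hz fun s => c.tsupport_subset i ?_
      refine closure_minimal (t := {x | F.segment (x, (S x).1, c.stepLength F i x (S x).1) s ∈
        tsupport (c.φ i)}) (fun x hx => c.segment_mem hx s) ?_ h
      exact (isClosed_tsupport _).preimage ((continuous_eval_const s).comp hseg)
    refine hc.path.continuousAt.congr ?_
    have hev : ∀ᶠ x in 𝓝 z.1, x ∉ closure {x | 0 < c.stepLength F i x (S x).1} :=
      isClosed_closure.isOpen_compl.mem_nhds hz'
    filter_upwards [(continuous_fst.tendsto z).eventually hev] with y hy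
    rw [c.step_of_stepLength_eq_zero (hS y.1)]
    exact ((c.stepLength_nonneg F i _ _).eq_or_lt.resolve_right
      fun h => hy (subset_closure h)).symm

theorem step_snd_of_le {x : X} {s : ℝ × (ℝ → E)} {t : ℝ} (ht : t ≤ s.1) :
    (c.step F i x s).2 t = s.2 t :=
  if_pos ht

theorem stepLength_smul [MulAction G X] (hF : IsGHomotopy G F) (g : G) (x : X) (a : ℝ) :
    c.stepLength F i (g • x) a = c.stepLength F i x a := by
  simp only [stepLength, hF.extendTime_smul, c.φ_smul]

theorem step_smul [MulAction G X] (hF : IsGHomotopy G F) (g : G) (x : X) (s : ℝ × (ℝ → E)) :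
    c.step F i (g • x) (smulPath g s) = smulPath g (c.step F i x s) := by
  have hseg (a r : ℝ) : F.segment (g • x, a, r) = g • F.segment (x, a, r) := by
    ext r
    exact hF.extendTime_smul g x _
  refine Prod.ext ?_ (funext fun t => ?_)
  · simp [step, smulPath, c.stepLength_smul hF]
  · simp only [step, smulPath, c.stepLength_smul hF, hseg, (c.lifting i).map_smul]
    split_ifs <;> rfl

/-! ### Finite compositions of steps and their progress -/

variable (F)

/-- Successive extensions along a list of indices. -/
noncomputable def steps (l : List ι) (x : X) (s : ℝ × (ℝ → E)) : ℝ × (ℝ → E) :=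
  l.foldl (fun s i => c.step F i x s) s

theorem steps_cons (i : ι) (l : List ι) (x : X) (s : ℝ × (ℝ → E)) :
    c.steps F (i :: l) x s = c.steps F l x (c.step F i x s) :=
  rfl

variable {F}

theorem isPartialLift_steps (l : List ι) {x : X} {s : ℝ × (ℝ → E)}
    (hs : IsPartialLift p f F x s) : IsPartialLift p f F x (c.steps F l x s) := by
  induction l generalizing s with
  | nil => exact hs
  | cons i l ih => exact ih (c.isPartialLift_step hs)

theorem isContinuousFamily_steps (l : List ι) {S : X → ℝ × (ℝ → E)}
    (hS : ∀ x, IsPartialLift p f F x (S x)) (hc : IsContinuousFamily S) :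
    IsContinuousFamily fun x => c.steps F l x (S x) := by
  induction l generalizing S with
  | nil => exact hc
  | cons i l ih => exact ih (fun x => c.isPartialLift_step (hS x)) (c.isContinuousFamily_step hS hc)

theorem le_steps_fst (l : List ι) (x : X) (s : ℝ × (ℝ → E)) : s.1 ≤ (c.steps F l x s).1 := by
  induction l generalizing s with
  | nil => exact le_rfl
  | cons i l ih =>
    exact (le_add_of_nonneg_right (c.stepLength_nonneg F i x s.1)).trans (ih (c.step F i x s))

theorem steps_snd_of_le (l : List ι) {x : X} {s : ℝ × (ℝ → E)} {t : ℝ} (ht : t ≤ s.1) :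
    (c.steps F l x s).2 t = s.2 t := by
  induction l generalizing s with
  | nil => rfl
  | cons i l ih =>
    exact (ih (ht.trans (le_add_of_nonneg_right (c.stepLength_nonneg F i x s.1)))).trans
      (c.step_snd_of_le ht)

theorem steps_smul [MulAction G X] (hF : IsGHomotopy G F) (l : List ι) (g : G) (x : X)
    (s : ℝ × (ℝ → E)) : c.steps F l (g • x) (smulPath g s) = smulPath g (c.steps F l x s) := by
  induction l generalizing s with
  | nil => rfl
  | cons i l ih => rw [steps_cons, steps_cons, c.step_smul hF, ih]

/-- While the `i`-th function is bounded below along the homotopy, a list containing `i` makes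
definite progress. -/
theorem add_le_steps_fst {l : List ι} (hi : i ∈ l) {x : X} {s : ℝ × (ℝ → E)} {ε b : ℝ}
    (hb : b ≤ s.1) (h : ∀ t ∈ Set.Icc b (b + 2 * ε), ε ≤ c.φ i (F.extendTime (x, t))) :
    b + ε / 2 ≤ (c.steps F l x s).1 := by
  induction l generalizing s with
  | nil => simp at hi
  | cons j l ih =>
    rcases List.mem_cons.1 hi with rfl | hi
    · refine le_trans ?_ (c.le_steps_fst l x _)
      -- Either earlier steps already went far enough, or this step has length at least `ε / 2`: in
      -- `t + φ`, the first term suffices for `t ≥ ε`, and for `t ≤ ε` the time `s.1 + t` is still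
      -- within `[b, b + 2ε]`.
      rcases le_total (b + ε) s.1 with h' | h'
      · exact le_add_of_le_of_nonneg (by linarith) (c.stepLength_nonneg F i x s.1)
      · refine add_le_add hb (c.le_stepLength F i fun t ht => ?_)
        rcases le_total ε t with h'' | h''
        · linarith [c.φ_nonneg i (F.extendTime (x, s.1 + t))]
        · linarith [h (s.1 + t) ⟨by linarith [ht.1], by linarith⟩, ht.1]
    · exact ih hi (hb.trans (le_add_of_nonneg_right (c.stepLength_nonneg F j x s.1)))

variable (F)

theorem locallyFinite_active : LocallyFinite fun i => {x : X | ∃ t, c.φ i (F (x, t)) ≠ 0} :=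
  (c.locallyFinite.preimage_continuous F.continuous).image_fst_of_compactSpace.subset
    fun _ x ⟨t, ht⟩ => ⟨(x, t), ht, rfl⟩

/-- The indices of the members of the cover that the homotopy meets over `x`. -/
noncomputable def active (x : X) : Finset ι :=
  ((c.locallyFinite_active F).point_finite x).toFinset

variable {F}

theorem mem_active {x : X} : i ∈ c.active F x ↔ ∃ t, c.φ i (F (x, t)) ≠ 0 := by
  simp [active]

theorem active_smul [MulAction G X] (hF : IsGHomotopy G F) (g : G) (x : X) :
    c.active F (g • x) = c.active F x := by
  ext i
  simp only [mem_active, hF.map_smul, c.φ_smul]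

theorem step_of_notMem_active {x : X} {s : ℝ × (ℝ → E)} (hs : IsPartialLift p f F x s)
    (hi : i ∉ c.active F x) : c.step F i x s = s := by
  refine c.step_of_stepLength_eq_zero hs ?_
  by_contra h
  have hpos := (c.stepLength_nonneg F i x s.1).lt_of_ne' h
  exact hi (c.mem_active.2 ⟨_, (c.φ_pos_of_le_stepLength F i hpos le_rfl hpos.le).ne'⟩)

theorem steps_filter (P : ι → Prop) [DecidablePred P] (l : List ι) {x : X} {s : ℝ × (ℝ → E)}
    (hs : IsPartialLift p f F x s) (hP : ∀ i ∈ c.active F x, P i) :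
    c.steps F (l.filter P) x s = c.steps F l x s := by
  induction l generalizing s with
  | nil => rfl
  | cons i l ih =>
    by_cases hi : P i
    · rw [List.filter_cons_of_pos (by simpa using hi), steps_cons, steps_cons,
        ih (c.isPartialLift_step hs)]
    · rw [List.filter_cons_of_neg (by simpa using hi), steps_cons,
        c.step_of_notMem_active hs fun h => hi (hP i h), ih hs]

/-- A Lebesgue number argument on `[0,1]`, with the constant uniform near `x`. -/
theorem exists_uniform_lower_bound (x : X) : ∃ ε > 0, ∀ᶠ y in 𝓝 x, ∀ a ∈ Set.Icc (0 : ℝ) 1,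
    ∃ i, ∀ t ∈ Set.Icc a (a + 2 * ε), ε ≤ c.φ i (F.extendTime (y, t)) := by
  refine isCompact_Icc.induction_on (p := fun A : Set ℝ => ∃ ε > 0, ∀ᶠ y in 𝓝 x, ∀ a ∈ A,
    ∃ i, ∀ t ∈ Set.Icc a (a + 2 * ε), ε ≤ c.φ i (F.extendTime (y, t))) ?_ ?_ ?_ ?_
  · exact ⟨1, one_pos, by simp⟩
  · rintro A A' hA ⟨ε, hε, h⟩
    exact ⟨ε, hε, h.mono fun y hy a ha => hy a (hA ha)⟩
  · rintro A A' ⟨ε, hε, h⟩ ⟨ε', hε', h'⟩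
    refine ⟨min ε ε', lt_min hε hε', ?_⟩
    filter_upwards [h, h'] with y hy hy' a ha
    rcases ha with ha | ha
    · obtain ⟨i, hi⟩ := hy a ha
      exact ⟨i, fun t ht => (min_le_left _ _).trans
        (hi t ⟨ht.1, by linarith [ht.2, min_le_left ε ε']⟩)⟩
    · obtain ⟨i, hi⟩ := hy' a ha
      exact ⟨i, fun t ht => (min_le_right _ _).trans
        (hi t ⟨ht.1, by linarith [ht.2, min_le_right ε ε']⟩)⟩
  · intro a _
    obtain ⟨i, hi⟩ := c.exists_pos (F.extendTime (x, a))
    have hcont : Continuous fun z : X × ℝ => c.φ i (F.extendTime z) :=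
      (c.continuous_φ i).comp F.extendTime.continuous
    have hev : ∀ᶠ z in 𝓝 (x, a), c.φ i (F.extendTime (x, a)) / 2 < c.φ i (F.extendTime z) :=
      hcont.continuousAt.eventually_const_lt (half_lt_self hi)
    obtain ⟨V, hV, W, hW, hVW⟩ := mem_nhds_prod_iff.1 hev
    obtain ⟨η, hη, hηW⟩ := Metric.mem_nhds_iff.1 hW
    -- With `ε ≤ η / 4`, an interval of length `2ε` starting within `η / 2` of `a` stays in the ball
    -- of radius `η`.
    refine ⟨Metric.ball a (η / 2), mem_nhdsWithin_of_mem_nhds (Metric.ball_mem_nhds a (half_pos hη)),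
      min (c.φ i (F.extendTime (x, a)) / 2) (η / 4), lt_min (half_pos hi) (by positivity), ?_⟩
    filter_upwards [hV] with y hy b hb
    refine ⟨i, fun t ht => (min_le_left _ _).trans (le_of_lt (hVW ⟨hy, hηW ?_⟩))⟩
    rw [Metric.mem_ball, Real.dist_eq, abs_lt] at hb ⊢
    have := min_le_right (c.φ i (F.extendTime (x, a)) / 2) (η / 4)
    constructor <;> linarith [hb.1, hb.2, ht.1, ht.2]

/-! ### Rounds of extensions and their stages -/

variable [LinearOrder ι]

variable (F) in
/-- One round of extensions, through all the members of the cover that the homotopy meets. -/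
noncomputable def pass (x : X) (s : ℝ × (ℝ → E)) : ℝ × (ℝ → E) :=
  c.steps F (c.active F x).sort x s

/-- Inactive indices act trivially, and the sorted lists are compatible because the order on indices
is fixed. A finite `A` containing all indices active near a point thus replaces the varying list by
a constant one. -/
theorem pass_eq_steps_sort {A : Finset ι} {x : X} {s : ℝ × (ℝ → E)}
    (hs : IsPartialLift p f F x s) (hA : c.active F x ⊆ A) :
    c.pass F x s = c.steps F A.sort x s := by
  rw [pass, ← c.steps_filter (· ∈ c.active F x) (A.sort (· ≤ ·)) hs fun _ => id]
  congr 1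
  refine List.Perm.eq_of_pairwise (le := (· ≤ ·)) (fun a b _ _ => le_antisymm)
    (Finset.pairwise_sort _ _) ((Finset.pairwise_sort _ _).filter _) ?_
  refine (List.perm_ext_iff_of_nodup (Finset.sort_nodup _ _)
    ((Finset.sort_nodup _ _).filter _)).2 fun a => ?_
  simpa using fun h => hA h

theorem isContinuousFamily_pass {S : X → ℝ × (ℝ → E)} (hS : ∀ x, IsPartialLift p f F x (S x))
    (hc : IsContinuousFamily S) : IsContinuousFamily fun x => c.pass F x (S x) := by
  refine isContinuousFamily_of_eventuallyEq fun x => ?_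
  obtain ⟨N, hN, hfin⟩ := c.locallyFinite_active F x
  refine ⟨_, c.isContinuousFamily_steps hfin.toFinset.sort hS hc, ?_⟩
  filter_upwards [hN] with y hy
  refine c.pass_eq_steps_sort (hS y) fun i hi => ?_
  rw [Set.Finite.mem_toFinset]
  exact ⟨y, c.mem_active.1 hi, hy⟩

theorem pass_smul [MulAction G X] (hF : IsGHomotopy G F) (g : G) (x : X) (s : ℝ × (ℝ → E)) :
    c.pass F (g • x) (smulPath g s) = smulPath g (c.pass F x s) := by
  rw [pass, c.active_smul hF, c.steps_smul hF, pass]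

/-- The partial lifts obtained after `k` rounds of extensions. -/
noncomputable def stage (f : X → E) (F : C(X × I, B)) (k : ℕ) (x : X) : ℝ × (ℝ → E) :=
  (c.pass F x)^[k] (0, fun _ => f x)

theorem stage_succ (k : ℕ) (x : X) : c.stage f F (k + 1) x = c.pass F x (c.stage f F k x) :=
  Function.iterate_succ_apply' _ _ _

theorem isPartialLift_stage (h0 : ∀ x, F (x, 0) = p (f x)) (k : ℕ) (x : X) :
    IsPartialLift p f F x (c.stage f F k x) := by
  induction k with
  | zero =>
    refine ⟨le_rfl, rfl, fun _ => rfl, fun t => ?_⟩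
    change p (f x) = F (x, Set.projIcc 0 1 zero_le_one (min t 0))
    rw [Set.projIcc_of_le_left _ (min_le_right t 0), ← h0]
    rfl
  | succ k ih =>
    rw [stage_succ]
    exact c.isPartialLift_steps _ ih

theorem isContinuousFamily_stage (hf : Continuous f) (h0 : ∀ x, F (x, 0) = p (f x)) (k : ℕ) :
    IsContinuousFamily (c.stage f F k) := by
  induction k with
  | zero => exact ⟨continuous_const, hf.comp continuous_fst⟩
  | succ k ih =>
    have := c.isContinuousFamily_pass (c.isPartialLift_stage h0 k) ih
    simpa only [← stage_succ] using this

theorem stage_smul [MulAction G X] (hF : IsGHomotopy G F) (hf : ∀ (g : G) x, f (g • x) = g • f x)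
    (k : ℕ) (g : G) (x : X) : c.stage f F k (g • x) = smulPath g (c.stage f F k x) := by
  induction k with
  | zero => exact Prod.ext rfl (funext fun t => hf g x)
  | succ k ih => rw [stage_succ, stage_succ, ih, c.pass_smul hF]

theorem stage_snd_of_le {k l : ℕ} (hkl : k ≤ l) {x : X} {t : ℝ} (ht : t ≤ (c.stage f F k x).1) :
    t ≤ (c.stage f F l x).1 ∧ (c.stage f F l x).2 t = (c.stage f F k x).2 t := by
  induction l, hkl using Nat.le_induction with
  | base => exact ⟨ht, rfl⟩
  | succ l _ ih =>
    rw [stage_succ]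
    exact ⟨ih.1.trans (c.le_steps_fst _ x _), (c.steps_snd_of_le _ ih.1).trans ih.2⟩

theorem eventually_one_le_stage_fst (h0 : ∀ x, F (x, 0) = p (f x)) (x : X) :
    ∃ k, ∀ᶠ y in 𝓝 x, 1 ≤ (c.stage f F k y).1 := by
  obtain ⟨ε, hε, h⟩ := c.exists_uniform_lower_bound (F := F) x
  obtain ⟨k, hk⟩ := exists_nat_ge (2 / ε)
  refine ⟨k, ?_⟩
  filter_upwards [h] with y hy
  -- Each round gains at least `ε / 2` until time 1, so `k ≥ 2 / ε` rounds suffice.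
  have key (n : ℕ) : min 1 (n * (ε / 2)) ≤ (c.stage f F n y).1 := by
    induction n with
    | zero => simp [stage]
    | succ n ih =>
      rw [stage_succ]
      rcases le_total 1 (c.stage f F n y).1 with h1 | h1
      · exact (min_le_left _ _).trans (h1.trans (c.le_steps_fst _ y _))
      · obtain ⟨i, hi⟩ := hy _ ⟨(c.isPartialLift_stage h0 n y).nonneg, h1⟩
        have hact : i ∈ c.active F y := c.mem_active.2
          ⟨_, (hε.trans_le (hi _ ⟨le_rfl, by linarith⟩)).ne'⟩
        have hadd : (c.stage f F n y).1 + ε / 2 ≤ (c.pass F y (c.stage f F n y)).1 :=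
          c.add_le_steps_fst ((Finset.mem_sort _).2 hact) le_rfl hi
        refine le_trans ?_ hadd
        rcases min_le_iff.1 ih with h' | h'
        · exact (min_le_left _ _).trans (by linarith)
        · exact (min_le_right _ _).trans (by push_cast; linarith)
  refine le_trans (le_min le_rfl ?_) (key k)
  rw [div_le_iff₀ hε] at hk
  linarith

/-! ### Gluing the stages -/

theorem hasGCoveringHomotopy (c : GLiftingCover G p ι) [MulAction G X] :
    HasGCoveringHomotopy G p X := by
  intro f F₀ hf hF h0
  obtain ⟨F, rfl⟩ : ∃ F : C(X × I, B), ⇑F = F₀ := ⟨⟨F₀, hF.continuous⟩, rfl⟩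
  have hex (x : X) : ∃ k, 1 ≤ (c.stage f F k x).1 :=
    let ⟨k, hk⟩ := c.eventually_one_le_stage_fst (f := f) (F := F) h0 x
    ⟨k, hk.self_of_nhds⟩
  choose K hK using hex
  -- The choice `K` need be neither continuous nor invariant: all stages that have reached time 1
  -- agree on `[0,1]`, so `K x` may be replaced by a locally constant number of rounds, or by the
  -- one chosen at another point of the orbit.
  have hstable {x : X} {k : ℕ} (hk : 1 ≤ (c.stage f F k x).1) (t : I) :
      (c.stage f F (K x) x).2 t = (c.stage f F k x).2 t := by
    rcases le_total k (K x) with h | h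
    · exact (c.stage_snd_of_le h (t.2.2.trans hk)).2
    · exact (c.stage_snd_of_le h (t.2.2.trans (hK x))).2.symm
  refine ⟨fun z => (c.stage f F (K z.1) z.1).2 z.2, ⟨?_, fun g x t => ?_⟩, fun z => ?_, fun x => ?_⟩
  · refine continuous_iff_continuousAt.2 fun z => ?_
    obtain ⟨k, hk⟩ := c.eventually_one_le_stage_fst (f := f) (F := F) h0 z.1
    have hpath := (c.isContinuousFamily_stage hf.continuous h0 k).path
    have hc : Continuous fun y : X × I => (c.stage f F k y.1).2 y.2 :=
      hpath.comp (g := fun z : X × ℝ => (c.stage f F k z.1).2 z.2)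
        (f := fun y : X × I => (y.1, (y.2 : ℝ))) (by fun_prop)
    refine hc.continuousAt.congr ?_
    filter_upwards [(continuous_fst.tendsto z).eventually hk] with y hy
    exact (hstable hy y.2).symm
  · have h := c.stage_smul hF hf.map_smul (K x) g x
    have h1 : 1 ≤ (c.stage f F (K x) (g • x)).1 := by
      rw [h]
      exact hK x
    change (c.stage f F (K (g • x)) (g • x)).2 t = _
    rw [hstable h1 t, h]
    rfl
  · refine ((c.isPartialLift_stage h0 (K z.1) z.1).lift z.2).trans ?_
    rw [min_eq_left (z.2.2.2.trans (hK z.1))]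
    change F (z.1, Set.projIcc 0 1 zero_le_one (z.2 : ℝ)) = F z
    rw [Set.projIcc_val]
  · exact (c.isPartialLift_stage h0 (K x) x).zero

end GLiftingCover

theorem theorem7 (G : Type w) [TopologicalSpace G] [Group G] [IsTopologicalGroup G]
    [CompactSpace G] (E : Type u) [TopologicalSpace E] [MulAction G E] [ContinuousSMul G E]
    (B : Type v) [TopologicalSpace B] [MulAction G B] [ContinuousSMul G B]
    [T2Space B] [ParacompactSpace B] (p : E → B) (hp : IsGMap G p) :
    IsHurewiczGFibration G p ↔ IsLocalHurewiczGFibration G p := by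
  refine ⟨IsHurewiczGFibration.isLocalHurewiczGFibration, fun h => ⟨hp, fun X _ _ _ => ?_⟩⟩
  obtain ⟨c⟩ := h.nonempty_gLiftingCover
  -- Here `B` serves only as the index set; the order need not respect its topology or action, since
  -- each `φ i` is itself invariant.
  let : LinearOrder B := IsWellOrder.linearOrder WellOrderingRel
  exact c.hasGCoveringHomotopy
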